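/- Let $n\in\{1,2,3\}$, $\lambda>0$, and let $\alpha_0\in\mathbb R$ and $l_0\in\mathbb R\setminus\{0\}$ be fixed. Put $\alpha=\frac{\lambda}{1+\lambda}\alpha_0$ and $l=\frac{\lambda}{1+\lambda}l_0$, and define the scattering coefficient of the point interaction by $$S_\lambda(k)=\frac{-i\alpha}{k+\frac{i}{2}\alpha}\ (n=1),\qquad S_\lambda(k)=\frac{-i\pi}{l^{-1}+\gamma+\ln\frac k2+i\frac{\pi}{2}}\ (n=2),\qquad S_\lambda(k)=\frac{-2ik}{l^{-1}+ik}\ (n=3),$$ where $\gamma$ is the Euler–Mascheroni constant. Functions in $L^2(\mathbb R^n\times\mathbb R^n)$ are written in the momentum representation as functions of $(k,K)$, the momenta of the light and of the heavy particle, where $\lambda$ is the ratio of the light mass to the heavy mass. The displacement and center-of-mass momenta are $k_d=\frac{1}{1+\lambda}k-\frac{\lambda}{1+\lambda}K$ and $K_{cm}=k+K$; the change of variables $(k,K)\mapsto(k_d,K_{cm})$ is unitary on $L^2$. In the variables $(k_d,K_{cm})$ the scattering operator is $$\mathbf S_\lambda=I+I_{cm}\otimes\big(S_\lambda(r)\otimes|\phi\rangle\langle\phi|\big),$$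 where $L^2(\mathbb R^n,dk_d)=L^2(\mathbb R^+,r^{n-1}dr)\otimes L^2(\partial B_1(0))$, $S_\lambda(r)$ acts by multiplication on the radial factor, $\phi=s_n^{-1/2}1_{\partial B_1(0)}$, and $s_n$ is the surface area of the unit sphere. Let $\mathbf A_\lambda=\mathbf S_\lambda-I$. Let $d\sigma$ denote the Haar measure of total mass one on $SO_n$ if $n=2,3$; if $n=1$, $SO_n$ is replaced by $\{+1,-1\}$ with mass $\frac12$ at each point. The scalar product is conjugate-linear in its first argument. Let $f,g\in L^2(\mathbb R^n\times\mathbb R^n)$. 1. The integrand below is integrable over $\mathbb R^n\times\mathbb R^n\times SO_n$, and $$\langle g|\mathbf A_\lambda f\rangle=(1+\lambda)^n\int_{\mathbb R^n\times\mathbb R^n}dk\,dK\int_{SO_n}d\sigma\;S_\lambda(|k|)\;\overline{g\big(k+\lambda(K+\sigma k),\,K+(\sigma-I)k\big)}\;f\big(\sigma k+\lambda(K+\sigma k),\,K\big).$$ 2. Suppose that $\lambda<1$, or that $\lambda>1$ and $n\neq1$. Write $\kappa=(I+\lambda\sigma)^{-1}(k-\lambda K)$. The integrand below is integrable over $\mathbb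 R^n\times\mathbb R^n\times SO_n$, and $$\langle g|\mathbf A_\lambda f\rangle=(1+\lambda)^n\int_{\mathbb R^n\times\mathbb R^n}dk\,dK\int_{SO_n}d\sigma\;\det(I+\lambda\sigma)^{-1}\,S_\lambda(|\kappa|)\;\overline{g\big(k,\,K+(\sigma-I)\kappa\big)}\;f\big(k+(\sigma-I)\kappa,\,K\big).$$ -/

import Mathlib

open MeasureTheory

noncomputable section

namespace PointScattering

/-- Momentum space `ℝⁿ` with its Euclidean norm. -/
abbrev Mom (n : ℕ) : Type := EuclideanSpace ℝ (Fin n)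

/-- The two-particle Hilbert space `L²(ℝⁿ × ℝⁿ)` in the momentum representation. -/
abbrev TwoBody (n : ℕ) : Type := Lp ℂ 2 (volume : Measure (Mom n × Mom n))

/-! ### The scattering coefficient -/

/-- The scattering coefficient `S_λ(k)` of the point interaction in dimension `n`. In dimension one
the resonance parameter is `α = λ/(1+λ) α₀`, in dimensions two and three the scattering length is
`l = λ/(1+λ) l₀`. There are no non-trivial point interactions in other dimensions. -/
def scatCoeff (n : ℕ) (α₀ l₀ lam k : ℝ) : ℂ :=
  match n with
  | 1 => (-Complex.I * ((lam / (1 + lam) * α₀ : ℝ) : ℂ)) /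
      ((k : ℂ) + Complex.I * (1 / 2) * ((lam / (1 + lam) * α₀ : ℝ) : ℂ))
  | 2 => (-Complex.I * (Real.pi : ℂ)) /
      ((((lam / (1 + lam) * l₀)⁻¹ + Real.eulerMascheroniConstant + Real.log (k / 2) : ℝ) : ℂ) +
        Complex.I * ((Real.pi / 2 : ℝ) : ℂ))
  | 3 => (-2 * Complex.I * (k : ℂ)) /
      ((((lam / (1 + lam) * l₀)⁻¹ : ℝ) : ℂ) + Complex.I * (k : ℂ))
  | _ => 0

lemma norm_le_two_mul {a : ℂ} {x y b : ℝ} (ha : ‖a‖ ≤ 2 * |b|) (hx : b = x ∨ b = y) :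
    ‖a / ((x : ℂ) + Complex.I * (y : ℂ))‖ ≤ 2 := by
  have h1 : |b| ≤ ‖(x : ℂ) + Complex.I * (y : ℂ)‖ := by
    rcases hx with rfl | rfl
    · simpa using Complex.abs_re_le_norm ((b : ℂ) + Complex.I * (y : ℂ))
    · simpa using Complex.abs_im_le_norm ((x : ℂ) + Complex.I * (b : ℂ))
  rw [norm_div]
  exact div_le_of_le_mul₀ (norm_nonneg _) zero_le_two (ha.trans (by linarith))

lemma norm_scatCoeff_le (n : ℕ) (α₀ l₀ lam k : ℝ) : ‖scatCoeff n α₀ l₀ lam k‖ ≤ 2 := by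
  unfold scatCoeff
  split
  · have := norm_le_two_mul (a := -Complex.I * ((lam / (1 + lam) * α₀ : ℝ) : ℂ)) (x := k)
      (y := 1 / 2 * (lam / (1 + lam) * α₀)) (b := 1 / 2 * (lam / (1 + lam) * α₀))
      (by
        rw [norm_mul, norm_neg, Complex.norm_I, Complex.norm_real, Real.norm_eq_abs, abs_mul (1 / 2)]
        norm_num
        linarith) (Or.inr rfl)
    convert this using 4
    push_cast
    ring
  · refine norm_le_two_mul (b := Real.pi / 2) ?_ (Or.inr rfl)
    rw [norm_mul, norm_neg, Complex.norm_I, Complex.norm_real, Real.norm_eq_abs, abs_div]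
    norm_num
    linarith
  · refine norm_le_two_mul (b := k) ?_ (Or.inr rfl)
    simp
  · simp

lemma measurable_scatCoeff (n : ℕ) (α₀ l₀ lam : ℝ) : Measurable (scatCoeff n α₀ l₀ lam) := by
  unfold scatCoeff
  split <;> fun_prop

/-! ### The rotation group -/

/-- The group of rotations: `SO(n)` for `n ≠ 1`, and `O(1) = {+1, -1}` for `n = 1`. (Over `ℝ` the
unitary matrices are the orthogonal ones.) -/
def rotGroup (n : ℕ) : Subgroup (Matrix.unitaryGroup (Fin n) ℝ) where
  carrier := {σ | n = 1 ∨ (σ : Matrix (Fin n) (Fin n) ℝ).det = 1}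
  mul_mem' := by
    rintro a b (h | ha) (h' | hb)
    all_goals first | exact Or.inl h | exact Or.inl h' | exact Or.inr (by simp [ha, hb])
  one_mem' := Or.inr (by simp)
  inv_mem' := by
    rintro a (h | ha)
    · exact Or.inl h
    · exact Or.inr (by
        simp [Matrix.star_eq_conjTranspose, ha])

/-- The matrix of a rotation. -/
abbrev rotMat {n : ℕ} (σ : rotGroup n) : Matrix (Fin n) (Fin n) ℝ := σ.1.1

instance (n : ℕ) : MeasurableSpace (rotGroup n) := borel _

instance (n : ℕ) : BorelSpace (rotGroup n) := ⟨rfl⟩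

instance (n : ℕ) : CompactSpace (rotGroup n) := by
  have hcl : Topology.IsClosedEmbedding (fun σ : rotGroup n => rotMat σ) := by
    have h1 : Topology.IsEmbedding (fun σ : rotGroup n => rotMat σ) :=
      Topology.IsEmbedding.subtypeVal.comp Topology.IsEmbedding.subtypeVal
    refine ⟨h1, ?_⟩
    have h2 : Set.range (fun σ : rotGroup n => rotMat σ) =
        {A | star A * A = 1} ∩ ({A | A * star A = 1} ∩ {A | n = 1 ∨ A.det = 1}) := by
      ext A
      constructor
      · rintro ⟨σ, rfl⟩
        exact ⟨(Unitary.mem_iff.1 σ.1.2).1, (Unitary.mem_iff.1 σ.1.2).2, σ.2⟩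
      · rintro ⟨h1, h2, h3⟩
        exact ⟨⟨⟨A, Unitary.mem_iff.2 ⟨h1, h2⟩⟩, h3⟩, rfl⟩
    rw [h2]
    refine (isClosed_eq (by fun_prop) continuous_const).inter
      ((isClosed_eq (by fun_prop) continuous_const).inter ?_)
    by_cases h : n = 1
    · simp [h]
    · simpa [h] using isClosed_eq (Continuous.matrix_det continuous_id) continuous_const
  have hK : IsCompact (Set.pi Set.univ fun _ : Fin n => Set.pi Set.univ fun _ : Fin n =>
      Set.Icc (-1 : ℝ) 1) :=
    isCompact_univ_pi fun _ => isCompact_univ_pi fun _ => isCompact_Icc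
  have := hcl.isCompact_preimage (K := (Set.pi Set.univ fun _ : Fin n => Set.pi Set.univ
    fun _ : Fin n => Set.Icc (-1 : ℝ) 1)) hK
  refine ⟨?_⟩
  convert this
  symm
  rw [Set.eq_univ_iff_forall]
  intro σ i _ j _
  have := entry_norm_bound_of_unitary σ.1.2 i j
  exact abs_le.1 (by simpa using this)

/-- The Haar measure on the rotation group, of total mass one. -/
def rotHaar (n : ℕ) : Measure (rotGroup n) := Measure.haarMeasure ⊤

/-! ### Multiplication operators and tensor products with a vector -/

/-- Multiplication by a bounded measurable function as an operator on `L²`. -/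
def mulOp {X : Type*} [MeasurableSpace X] {μ : Measure X} (m : X → ℂ) (hm : MemLp m ⊤ μ) :
    Lp ℂ 2 μ →L[ℂ] Lp ℂ 2 μ :=
  (ContinuousLinearMap.mul ℂ ℂ).holderL μ ⊤ 2 2 (hm.toLp m)

lemma eLpNorm_tensor {X Y : Type*} [MeasurableSpace X] [MeasurableSpace Y] {μ : Measure X}
    {ν : Measure Y} [SFinite μ] [SFinite ν] {φ : X → ℂ} {h : Y → ℂ}
    (hφ : AEStronglyMeasurable φ μ) (hh : AEStronglyMeasurable h ν) :
    eLpNorm (fun p : X × Y => φ p.1 * h p.2) 2 (μ.prod ν) = eLpNorm φ 2 μ * eLpNorm h 2 ν := by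
  rw [eLpNorm_eq_lintegral_rpow_enorm_toReal (by simp) (by simp),
    eLpNorm_eq_lintegral_rpow_enorm_toReal (by simp) (by simp),
    eLpNorm_eq_lintegral_rpow_enorm_toReal (by simp) (by simp),
    ← ENNReal.mul_rpow_of_nonneg _ _ (by simp),
    ← lintegral_prod_mul (hφ.enorm.pow_const _) (hh.enorm.pow_const _)]
  simp only [enorm_mul, ENNReal.mul_rpow_of_nonneg _ _ ENNReal.toReal_nonneg]

lemma memLp_tensor {X Y : Type*} [MeasurableSpace X] [MeasurableSpace Y] {μ : Measure X}
    {ν : Measure Y} [SFinite μ] [SFinite ν] {φ : X → ℂ} {h : Y → ℂ}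
    (hφ : MemLp φ 2 μ) (hh : MemLp h 2 ν) :
    MemLp (fun p : X × Y => φ p.1 * h p.2) 2 (μ.prod ν) :=
  ⟨hφ.1.comp_fst.mul hh.1.comp_snd, by
    rw [eLpNorm_tensor hφ.1 hh.1]
    exact ENNReal.mul_lt_top hφ.2 hh.2⟩

/-- The operator `h ↦ φ ⊗ h`, where `(φ ⊗ h)(x, y) = φ x * h y`. -/
def tensorOp {X Y : Type*} [MeasurableSpace X] [MeasurableSpace Y] {μ : Measure X} {ν : Measure Y}
    [SFinite μ] [SFinite ν] (φ : Lp ℂ 2 μ) : Lp ℂ 2 ν →L[ℂ] Lp ℂ 2 (μ.prod ν) :=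
  LinearMap.mkContinuous
    { toFun := fun h => (memLp_tensor (Lp.memLp φ) (Lp.memLp h)).toLp _
      map_add' := fun h₁ h₂ => by
        rw [← MemLp.toLp_add]
        refine MemLp.toLp_congr _ _ ?_
        filter_upwards [Measure.quasiMeasurePreserving_snd.ae (Lp.coeFn_add h₁ h₂)] with p hp
        simp only [Pi.add_apply] at hp ⊢
        rw [hp, mul_add]
      map_smul' := fun c h => by
        rw [RingHom.id_apply, ← MemLp.toLp_const_smul]
        refine MemLp.toLp_congr _ _ ?_
        filter_upwards [Measure.quasiMeasurePreserving_snd.ae (Lp.coeFn_smul c h)] with p hp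
        simp only [Pi.smul_apply, smul_eq_mul] at hp ⊢
        rw [hp, mul_left_comm] }
    ‖φ‖ (fun h => by
      simp only [LinearMap.coe_mk, AddHom.coe_mk]
      rw [Lp.norm_toLp, eLpNorm_tensor (Lp.memLp φ).1 (Lp.memLp h).1, ENNReal.toReal_mul]
      rfl)

/-! ### Center-of-mass and polar coordinates -/

/-- For light-particle momentum `k` and heavy-particle momentum `K`, the pair of the displacement
momentum `k_d = k/(1+λ) - λ/(1+λ) K` and the center-of-mass momentum `K_cm = k + K`. -/
def cmCoord (n : ℕ) (lam : ℝ) (q : Mom n × Mom n) : Mom n × Mom n :=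
  ((1 / (1 + lam)) • q.1 - (lam / (1 + lam)) • q.2, q.1 + q.2)

lemma measurePreserving_cmCoord (n : ℕ) {lam : ℝ} (hlam : 0 < lam) :
    MeasurePreserving (cmCoord n lam) := by
  have h1 : MeasurePreserving (fun q : Mom n × Mom n => (q.1, q.1 + q.2)) :=
    measurePreserving_prod_add volume volume
  have h2 : MeasurePreserving (fun q : Mom n × Mom n => (q.1 + (-(lam / (1 + lam))) • q.2, q.2)) := by
    have : MeasurePreserving
        (fun q : Mom n × Mom n => (q.1, (-(lam / (1 + lam))) • q.1 + q.2)) :=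
      (MeasurePreserving.id volume).skew_product (by fun_prop)
        (Filter.Eventually.of_forall fun a => map_add_left_eq_self _ _)
    have h3 := (Measure.measurePreserving_swap.comp this).comp
      (Measure.measurePreserving_swap (μ := (volume : Measure (Mom n)))
        (ν := (volume : Measure (Mom n))))
    have h4 : (fun q : Mom n × Mom n => (q.1 + (-(lam / (1 + lam))) • q.2, q.2)) =
        (Prod.swap ∘ fun q : Mom n × Mom n => (q.1, (-(lam / (1 + lam))) • q.1 + q.2)) ∘
          Prod.swap := by
      ext1 q
      simp [add_comm]
    rw [h4]
    exact h3
  convert h2.comp h1 using 1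
  ext1 q
  have h0 : 1 + lam ≠ 0 := by positivity
  have h4 : (1 : ℝ) / (1 + lam) = 1 + -(lam / (1 + lam)) := by field_simp; ring
  simp only [cmCoord, Function.comp_apply, Prod.mk.injEq, and_true]
  rw [h4]
  module

/-- The unitary change of variables `F ↦ F ∘ cmCoord` from functions of `(k_d, K_cm)` to functions
of `(k, K)`. -/
def cmOp (n : ℕ) {lam : ℝ} (hlam : 0 < lam) : TwoBody n →L[ℂ] TwoBody n :=
  (Lp.compMeasurePreservingₗᵢ ℂ (cmCoord n lam)
    (measurePreserving_cmCoord n hlam)).toContinuousLinearMap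

/-- The unit sphere `∂B₁(0)` of `ℝⁿ`. -/
abbrev Sph (n : ℕ) : Type := Metric.sphere (0 : Mom n) 1

/-- The surface measure of the unit sphere (counting measure if `n = 1`). -/
abbrev sphMeasure (n : ℕ) : Measure (Sph n) := (volume : Measure (Mom n)).toSphere

/-- The measure `r ^ (n - 1) dr dK_cm` on pairs of the radius `r` of the displacement momentum and
the center-of-mass momentum. -/
abbrev radMeasure (n : ℕ) : Measure (Set.Ioi (0 : ℝ) × Mom n) :=
  (Measure.volumeIoiPow (n - 1)).prod volume

/-- The map `(ω, (r, K_cm)) ↦ (r ω, K_cm)`. -/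
def polarMap (n : ℕ) (p : Sph n × (Set.Ioi (0 : ℝ) × Mom n)) : Mom n × Mom n :=
  ((p.2.1 : ℝ) • (p.1 : Mom n), p.2.2)

lemma measurePreserving_polarMap (n : ℕ) [NeZero n] :
    MeasurePreserving (polarMap n) ((sphMeasure n).prod (radMeasure n)) := by
  have h1 := ((volume : Measure (Mom n)).measurePreserving_homeomorphUnitSphereProd).symm
    (homeomorphUnitSphereProd (Mom n)).toMeasurableEquiv
  rw [finrank_euclideanSpace_fin] at h1
  have h2 : MeasurePreserving (Subtype.val : ({0}ᶜ : Set (Mom n)) → Mom n)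
      ((volume : Measure (Mom n)).comap Subtype.val) volume := by
    have := measurePreserving_subtype_coe (μa := (volume : Measure (Mom n)))
      (s := ({0}ᶜ : Set (Mom n))) (measurableSet_singleton _).compl
    rwa [restrict_compl_singleton] at this
  have h3 := ((h2.comp h1).prod (MeasurePreserving.id (volume : Measure (Mom n)))).comp
    ((measurePreserving_prodAssoc (sphMeasure n) (Measure.volumeIoiPow (n - 1))
      (volume : Measure (Mom n))).symm MeasurableEquiv.prodAssoc)
  exact h3

/-- The unitary passage to polar coordinates in the displacement momentum,
`F ↦ ((ω, (r, K_cm)) ↦ F (r ω, K_cm))`. -/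
def polarOp (n : ℕ) [NeZero n] : TwoBody n →L[ℂ] Lp ℂ 2 ((sphMeasure n).prod (radMeasure n)) :=
  (Lp.compMeasurePreservingₗᵢ ℂ (polarMap n)
    (measurePreserving_polarMap n)).toContinuousLinearMap

/-! ### The scattering operator -/

/-- The normalized indicator function `φ = s_n ^ (-1/2) 1` of the unit sphere, where `s_n` is the
surface area of the sphere. -/
def sphConst (n : ℕ) : Lp ℂ 2 (sphMeasure n) :=
  indicatorConstLp 2 MeasurableSet.univ (measure_ne_top _ _)
    ((((sphMeasure n).real Set.univ) ^ (-(1 / 2) : ℝ) : ℝ) : ℂ)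

lemma memLp_scatCoeff (n : ℕ) (α₀ l₀ lam : ℝ) :
    MemLp (fun y : Set.Ioi (0 : ℝ) × Mom n => scatCoeff n α₀ l₀ lam y.1) ⊤ (radMeasure n) :=
  memLp_top_of_bound
    ((measurable_scatCoeff n α₀ l₀ lam).comp (by fun_prop)).aestronglyMeasurable 2
    (Filter.Eventually.of_forall fun _ => norm_scatCoeff_le _ _ _ _ _)

/-- The scattering operator in center-of-mass momentum coordinates, `I + S(r) ⊗ |φ⟩⟨φ| ⊗ I_cm` in
the decomposition of the displacement momentum into radius `r` and angle. Here `|φ⟩⟨φ| ⊗ I` is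
`tensorOp φ ∘ (tensorOp φ)†`. -/
def scatOpCM (n : ℕ) [NeZero n] (α₀ l₀ lam : ℝ) : TwoBody n →L[ℂ] TwoBody n :=
  ContinuousLinearMap.id ℂ _ +
    (polarOp n).adjoint ∘L tensorOp (sphConst n) ∘L mulOp _ (memLp_scatCoeff n α₀ l₀ lam) ∘L
      (tensorOp (sphConst n)).adjoint ∘L polarOp n

/-- The scattering operator `S_λ` on functions of the momenta `(k, K)` of the light and of the heavy
particle. -/
def scatOp (n : ℕ) [NeZero n] (α₀ l₀ : ℝ) {lam : ℝ} (hlam : 0 < lam) :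
    TwoBody n →L[ℂ] TwoBody n :=
  cmOp n hlam ∘L scatOpCM n α₀ l₀ lam ∘L (cmOp n hlam).adjoint

/-- `A_λ = S_λ - I`. -/
def opA (n : ℕ) [NeZero n] (α₀ l₀ : ℝ) {lam : ℝ} (hlam : 0 < lam) : TwoBody n →L[ℂ] TwoBody n :=
  scatOp n α₀ l₀ hlam - ContinuousLinearMap.id ℂ _

/-- The action of a matrix on `ℝⁿ`. -/
abbrev act {n : ℕ} (M : Matrix (Fin n) (Fin n) ℝ) (v : Mom n) : Mom n :=
  Matrix.toEuclideanLin M v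

/-- The integrand of the first representation, at `q = (k, K)` and the rotation `σ`. -/
def formIntegrand₁ {n : ℕ} (α₀ l₀ lam : ℝ) (f g : Mom n × Mom n → ℂ) (q : Mom n × Mom n)
    (σ : rotGroup n) : ℂ :=
  scatCoeff n α₀ l₀ lam ‖q.1‖ *
    starRingEnd ℂ (g (q.1 + lam • (q.2 + act (rotMat σ) q.1), q.2 + act (rotMat σ - 1) q.1)) *
    f (act (rotMat σ) q.1 + lam • (q.2 + act (rotMat σ) q.1), q.2)

/-- The integrand of the second representation, at `q = (k, K)` and the rotation `σ`. -/
def formIntegrand₂ {n : ℕ} (α₀ l₀ lam : ℝ) (f g : Mom n × Mom n → ℂ) (q : Mom n × Mom n)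
    (σ : rotGroup n) : ℂ :=
  (((1 + lam • rotMat σ).det : ℂ))⁻¹ *
    scatCoeff n α₀ l₀ lam ‖act (1 + lam • rotMat σ)⁻¹ (q.1 - lam • q.2)‖ *
    starRingEnd ℂ
      (g (q.1, q.2 + act ((rotMat σ - 1) * (1 + lam • rotMat σ)⁻¹) (q.1 - lam • q.2))) *
    f (q.1 + act ((rotMat σ - 1) * (1 + lam • rotMat σ)⁻¹) (q.1 - lam • q.2), q.2)

end PointScattering

end

/-!
The matrix elements of `A_λ` are computed in center-of-mass variables and then transported to the
momenta of the two particles by linear changes of variables.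

Conjugation by the unitary `cmOp` reduces `⟨g| A_λ f⟩` to the form of `S(r) ⊗ |φ⟩⟨φ| ⊗ I_cm` on the
functions `F` and `G` obtained from `f` and `g` by passing to the variables `(k_d, K_cm)`. Since
`|φ⟩⟨φ| ⊗ I = T T†` with `T = φ ⊗ ·`, and `T†` integrates over the sphere (`adjoint_tensorOp_ae`),
that form is `∫ S(r) conj (c ∫ G(rω, K) dω) (c ∫ F(rω', K) dω')` with `c² = 1 / s_n`. Rotations act
transitively on the sphere (`exists_rotMat_act_eq`), Haar measure is right invariant and the surface
measure is rotation invariant, so for every `ω` the spherical mean of `F(r ·, K)` is the average of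
`F(r σω, K)` over rotations `σ` (`integral_rotSph`). Hence (`inner_scatOpCM`) the form equals
`∫∫ S(|k|) conj G(k, K) F(σk, K)` over `(k, K)` and `σ`. Its integrand is integrable, because
`(k, K, σ) ↦ (σk, K)` preserves measure and `S` is bounded.

The first representation follows by the substitution `K_cm = (1 + λ) (K + σk)` at fixed `k` and `σ`,
with Jacobian `(1 + λ)ⁿ`. The second follows from the first by replacing `k` with
`(1 + λσ)⁻¹ (k - λK)` at fixed `K` and `σ`. Its Jacobian is `det (1 + λσ)⁻¹` without absolute value:
for `λ < 1` the matrix `1 + tσ` is injective for all `t ∈ [0, λ]`, and for `λ > 1`, `det σ = 1` one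
factors out `λσ` (`det_one_add_smul_rotMat_pos`). Both substitutions are instances of
`integral_comp_fiberwise`.
-/

open MeasureTheory

noncomputable section

namespace PointScattering

/-! ### Rotations acting on momentum space and on the sphere -/

lemma act_mul {n : ℕ} (A B : Matrix (Fin n) (Fin n) ℝ) (v : Mom n) :
    act (A * B) v = act A (act B v) := by
  simp [act]

lemma act_one {n : ℕ} (v : Mom n) : act (1 : Matrix (Fin n) (Fin n) ℝ) v = v := by
  simp [act]

lemma act_sub_one {n : ℕ} (A : Matrix (Fin n) (Fin n) ℝ) (v : Mom n) :
    act (A - 1) v = act A v - v := by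
  simp [act]

lemma act_one_add_smul {n : ℕ} (t : ℝ) (A : Matrix (Fin n) (Fin n) ℝ) (v : Mom n) :
    act (1 + t • A) v = v + t • act A v := by
  simp [act]

lemma norm_act_of_mem_unitaryGroup {n : ℕ} {M : Matrix (Fin n) (Fin n) ℝ}
    (hM : M ∈ Matrix.unitaryGroup (Fin n) ℝ) (v : Mom n) : ‖act M v‖ = ‖v‖ := by
  have h : inner ℝ (act M v) (act M v) = inner ℝ v v := by
    have h1 := LinearMap.adjoint_inner_right (Matrix.toEuclideanLin M) v (act M v)
    have h2 : act M.conjTranspose (act M v) = v := by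
      rw [← act_mul, ← Matrix.star_eq_conjTranspose, (Unitary.mem_iff.1 hM).1, act_one]
    rw [← h1, ← Matrix.toEuclideanLin_conjTranspose_eq_adjoint]
    exact congrArg (inner ℝ v) h2
  rw [real_inner_self_eq_norm_sq, real_inner_self_eq_norm_sq] at h
  exact (sq_eq_sq₀ (norm_nonneg _) (norm_nonneg _)).1 h

lemma norm_act_rotMat {n : ℕ} (σ : rotGroup n) (v : Mom n) : ‖act (rotMat σ) v‖ = ‖v‖ :=
  norm_act_of_mem_unitaryGroup σ.1.2 v

lemma exists_unitary_of_linearIsometryEquiv {n : ℕ} (L : Mom n ≃ₗᵢ[ℝ] Mom n) :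
    ∃ M ∈ Matrix.unitaryGroup (Fin n) ℝ, ∀ v, act M v = L v := by
  let φ := Matrix.toEuclideanCLM (n := Fin n) (𝕜 := ℝ)
  let U : unitary (Mom n →L[ℝ] Mom n) := Unitary.linearIsometryEquiv.symm L
  have h : φ (φ.symm U.1) = U.1 := φ.apply_symm_apply _
  refine ⟨φ.symm U.1, Unitary.mem_iff.2 ⟨EquivLike.injective φ ?_, EquivLike.injective φ ?_⟩,
    fun v => ?_⟩
  · rw [map_mul, map_star, h, map_one, (Unitary.mem_iff.1 U.2).1]
  · rw [map_mul, map_star, h, map_one, (Unitary.mem_iff.1 U.2).2]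
  · change φ (φ.symm U.1) v = L v
    rw [h]
    rfl

lemma det_of_act_eq {n : ℕ} {M : Matrix (Fin n) (Fin n) ℝ} {L : Mom n →ₗ[ℝ] Mom n}
    (h : ∀ v, act M v = L v) : M.det = LinearMap.det L := by
  rw [← LinearMap.det_toLpLin 2 M]
  congr 1
  ext1 v
  exact h v

/-- Rotations act transitively on spheres: a reflection maps `v` to `w`, and if its determinant has
the wrong sign it is followed by the reflection in a direction orthogonal to `w`. -/
lemma exists_rotMat_act_eq {n : ℕ} {v w : Mom n} (h : ‖v‖ = ‖w‖) :
    ∃ σ : rotGroup n, act (rotMat σ) v = w := by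
  obtain ⟨M, hM, hMv⟩ := exists_unitary_of_linearIsometryEquiv
    (Submodule.reflection (Submodule.span ℝ {v - w})ᗮ)
  have hvw : act M v = w := by rw [hMv, Submodule.reflection_sub h]
  by_cases h1 : n = 1 ∨ M.det = 1
  · exact ⟨⟨⟨M, hM⟩, h1⟩, hvw⟩
  push Not at h1
  obtain ⟨hn, hdet⟩ := h1
  have hdet' : M.det = -1 := by
    have h2 : M.det * M.det = 1 := by
      have := congrArg Matrix.det (Unitary.mem_iff.1 hM).1
      simpa [Matrix.det_mul, Matrix.star_eq_conjTranspose] using this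
    exact (mul_self_eq_one_iff.1 h2).resolve_left hdet
  have hn0 : n ≠ 0 := by
    rintro rfl
    exact hdet (by simp)
  obtain ⟨u, hu, hu0⟩ : ∃ u ∈ (Submodule.span ℝ {w})ᗮ, u ≠ 0 := by
    refine Submodule.exists_mem_ne_zero_of_ne_bot fun hbot => ?_
    have h3 := Submodule.finrank_add_finrank_orthogonal (Submodule.span ℝ {w})
    have h4 : Module.finrank ℝ (Submodule.span ℝ {w}) ≤ 1 :=
      (finrank_span_le_card (R := ℝ) ({w} : Set (Mom n))).trans (by simp)
    rw [hbot, finrank_bot, finrank_euclideanSpace_fin] at h3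
    omega
  obtain ⟨R, hR, hRv⟩ := exists_unitary_of_linearIsometryEquiv
    (Submodule.reflection (Submodule.span ℝ {u})ᗮ)
  have hRw : act R w = w := by
    rw [hRv]
    refine Submodule.reflection_mem_subspace_eq_self ?_
    rw [Submodule.mem_orthogonal_singleton_iff_inner_right] at hu ⊢
    rwa [real_inner_comm]
  have hRdet : R.det = -1 := by
    rw [det_of_act_eq (L := (Submodule.reflection (Submodule.span ℝ {u})ᗮ).toLinearMap) hRv]
    rw [Submodule.det_reflection, Submodule.orthogonal_orthogonal, finrank_span_singleton hu0,
      pow_one]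
  refine ⟨⟨⟨R * M, mul_mem hR hM⟩, Or.inr ?_⟩, ?_⟩
  · simp [Matrix.det_mul, hRdet, hdet']
  · change act (R * M) v = w
    rw [act_mul, hvw, hRw]

instance (n : ℕ) : SecondCountableTopology (rotGroup n) :=
  have : SecondCountableTopology (Matrix (Fin n) (Fin n) ℝ) :=
    inferInstanceAs (SecondCountableTopology (Fin n → Fin n → ℝ))
  (Topology.IsEmbedding.subtypeVal.comp Topology.IsEmbedding.subtypeVal :
    Topology.IsEmbedding fun σ : rotGroup n => rotMat σ).secondCountableTopology

lemma continuous_rotMat (n : ℕ) : Continuous fun σ : rotGroup n => rotMat σ :=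
  continuous_subtype_val.comp continuous_subtype_val

lemma continuous_act {X : Type*} [TopologicalSpace X] {n : ℕ} {M : X → Matrix (Fin n) (Fin n) ℝ}
    {v : X → Mom n} (hM : Continuous M) (hv : Continuous v) :
    Continuous fun x => act (M x) (v x) := by
  have h : (fun x => act (M x) (v x)) = fun x => WithLp.toLp 2 ((M x).mulVec (v x).ofLp) := by
    ext1 x
    exact Matrix.toLpLin_apply _ _ _ _
  rw [h]
  have h1 : Continuous fun x => (v x).ofLp := (PiLp.continuous_ofLp 2 _).comp hv
  exact (PiLp.continuous_toLp 2 _).comp (hM.matrix_mulVec h1)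

/-- The linear isometry given by a rotation. -/
def rotIso {n : ℕ} (σ : rotGroup n) : Mom n ≃ₗᵢ[ℝ] Mom n :=
  LinearIsometry.toLinearIsometryEquiv ⟨Matrix.toEuclideanLin (rotMat σ), norm_act_rotMat σ⟩ rfl

/-- The action of a rotation on the unit sphere. -/
def rotSph {n : ℕ} (σ : rotGroup n) (ω : Sph n) : Sph n :=
  ⟨act (rotMat σ) ω, by simp [norm_act_rotMat σ]⟩

lemma continuous_rotSph (n : ℕ) : Continuous fun p : rotGroup n × Sph n => rotSph p.1 p.2 :=
  (continuous_act ((continuous_rotMat n).comp continuous_fst)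
    (continuous_subtype_val.comp continuous_snd)).subtype_mk _

lemma rotSph_mul {n : ℕ} (σ τ : rotGroup n) (ω : Sph n) :
    rotSph (σ * τ) ω = rotSph σ (rotSph τ ω) :=
  Subtype.ext (act_mul _ _ _)

lemma measurable_rotSph (n : ℕ) : Measurable fun p : rotGroup n × Sph n => rotSph p.1 p.2 :=
  (continuous_rotSph n).measurable

lemma measurable_rotSph_right {n : ℕ} (σ : rotGroup n) : Measurable (rotSph σ) :=
  (measurable_rotSph n).of_uncurry_left (x := σ)

lemma measurable_rotSph_left {n : ℕ} (ω : Sph n) : Measurable fun σ : rotGroup n => rotSph σ ω :=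
  (measurable_rotSph n).of_uncurry_right (y := ω)

lemma measurePreserving_rotSph {n : ℕ} (σ : rotGroup n) :
    MeasurePreserving (rotSph σ) (sphMeasure n) (sphMeasure n) := by
  have hm : Measurable (rotSph σ) := measurable_rotSph_right σ
  refine ⟨hm, Measure.ext fun s hs => ?_⟩
  rw [Measure.map_apply hm hs, Measure.toSphere_apply' _ hs, Measure.toSphere_apply' _ (hm hs)]
  congr 1
  -- both cones over the sphere are compared through the isometry `σ` of the whole space
  conv_rhs => rw [← (rotIso σ).measurePreserving.measure_preimage_emb
    (rotIso σ).toHomeomorph.measurableEmbedding]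
  congr 1
  ext v
  simp only [Set.mem_smul, Set.mem_image, Set.mem_preimage]
  constructor
  · rintro ⟨r, hr, _, ⟨ω, hω, rfl⟩, rfl⟩
    exact ⟨r, hr, _, ⟨_, hω, rfl⟩, ((rotIso σ).map_smul r (ω : Mom n)).symm⟩
  · rintro ⟨r, hr, _, ⟨ω, hω, rfl⟩, hv⟩
    refine ⟨r, hr, (rotIso σ).symm ω, ⟨⟨(rotIso σ).symm ω, by simp⟩, ?_, rfl⟩, ?_⟩
    · convert hω
      exact Subtype.ext ((rotIso σ).apply_symm_apply _)
    · rw [← map_smul, hv, LinearIsometryEquiv.symm_apply_apply]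

instance (n : ℕ) : IsProbabilityMeasure (rotHaar n) :=
  ⟨Measure.haarMeasure_self (K₀ := (⊤ : TopologicalSpace.PositiveCompacts (rotGroup n)))⟩

instance (n : ℕ) : (rotHaar n).IsHaarMeasure := Measure.isHaarMeasure_haarMeasure ⊤

/-- Haar measure on the rotations is right invariant: a right translate is again a left-invariant
probability measure, hence equal to it. -/
lemma map_mul_right_rotHaar {n : ℕ} (τ : rotGroup n) :
    (rotHaar n).map (· * τ) = rotHaar n := by
  have hm : Measurable fun σ : rotGroup n => σ * τ := (continuous_mul_const τ).measurable
  have : IsProbabilityMeasure ((rotHaar n).map (· * τ)) :=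
    Measure.isProbabilityMeasure_map hm.aemeasurable
  exact Measure.isHaarMeasure_eq_of_isProbabilityMeasure _ _

/-- Averages over the orbit of a point of the sphere are spherical averages: averaging over all
`ω` shows that the orbit average, which is independent of `ω`, is the spherical average. -/
lemma lintegral_rotSph {n : ℕ} (ω : Sph n) {h : Sph n → ENNReal} (hh : Measurable h) :
    (∫⁻ σ, h (rotSph σ ω) ∂rotHaar n) * sphMeasure n Set.univ = ∫⁻ x, h x ∂sphMeasure n := by
  have hconst : ∀ ω' : Sph n,
      ∫⁻ σ, h (rotSph σ ω') ∂rotHaar n = ∫⁻ σ, h (rotSph σ ω) ∂rotHaar n := by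
    intro ω'
    obtain ⟨τ, hτ⟩ := exists_rotMat_act_eq (v := (ω : Mom n)) (w := ω') (by simp)
    have hτ' : ω' = rotSph τ ω := Subtype.ext hτ.symm
    have hm : Measurable fun σ : rotGroup n => h (rotSph σ ω) :=
      hh.comp (measurable_rotSph_left ω)
    conv_rhs => rw [← map_mul_right_rotHaar τ]
    rw [lintegral_map hm (continuous_mul_const τ).measurable, hτ']
    simp only [rotSph_mul]
  calc (∫⁻ σ, h (rotSph σ ω) ∂rotHaar n) * sphMeasure n Set.univ
      = ∫⁻ ω', ∫⁻ σ, h (rotSph σ ω') ∂rotHaar n ∂sphMeasure n := by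
        simp only [hconst, lintegral_const]
    _ = ∫⁻ σ, ∫⁻ ω', h (rotSph σ ω') ∂sphMeasure n ∂rotHaar n :=
        lintegral_lintegral_swap
          (hh.comp ((measurable_rotSph n).comp measurable_swap)).aemeasurable
    _ = ∫⁻ x, h x ∂sphMeasure n := by
        simp only [(measurePreserving_rotSph _).lintegral_comp hh, lintegral_const,
          measure_univ, mul_one]

/-- The orbit map `σ ↦ σ ω` sends the Haar probability measure to the normalized surface measure. -/
lemma map_rotSph {n : ℕ} [NeZero n] (ω : Sph n) :
    (rotHaar n).map (fun σ => rotSph σ ω) = (sphMeasure n Set.univ)⁻¹ • sphMeasure n := by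
  have hm : Measurable fun σ : rotGroup n => rotSph σ ω := measurable_rotSph_left ω
  have h0 : sphMeasure n Set.univ ≠ 0 := by
    rw [Ne, Measure.measure_univ_eq_zero]
    exact Measure.toSphere_ne_zero _
  refine Measure.ext fun s hs => ?_
  have h1 := lintegral_rotSph ω (measurable_one.indicator hs)
  rw [lintegral_indicator_one hs] at h1
  have h2 : ∫⁻ σ, s.indicator 1 (rotSph σ ω) ∂rotHaar n =
      (rotHaar n).map (fun σ => rotSph σ ω) s := by
    rw [← lintegral_indicator_one hs, lintegral_map (measurable_one.indicator hs) hm]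
  rw [h2] at h1
  rw [Measure.smul_apply, smul_eq_mul, ← h1, mul_comm, mul_assoc,
    ENNReal.mul_inv_cancel h0 (measure_ne_top _ _), mul_one]

lemma integral_rotSph {n : ℕ} [NeZero n] (ω : Sph n) {h : Sph n → ℂ}
    (hh : AEStronglyMeasurable h (sphMeasure n)) :
    ∫ σ, h (rotSph σ ω) ∂rotHaar n = ((sphMeasure n).real Set.univ)⁻¹ • ∫ x, h x ∂sphMeasure n := by
  have hm : Measurable fun σ : rotGroup n => rotSph σ ω := measurable_rotSph_left ω
  rw [← integral_map (φ := fun σ => rotSph σ ω) hm.aemeasurable, map_rotSph ω,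
    integral_smul_measure, ENNReal.toReal_inv]
  · rfl
  · rw [map_rotSph ω]
    exact hh.smul_measure _

/-! ### The quadratic form of the radial part -/

/-- The adjoint of `h ↦ φ ⊗ h` integrates out the first variable against `conj φ`. -/
lemma adjoint_tensorOp_ae {X Y : Type*} [MeasurableSpace X] [MeasurableSpace Y] {μ : Measure X}
    {ν : Measure Y} [SFinite μ] [SigmaFinite ν] (φ : Lp ℂ 2 μ) (Q : Lp ℂ 2 (μ.prod ν)) :
    (tensorOp (ν := ν) φ).adjoint Q =ᵐ[ν] fun y => ∫ x, starRingEnd ℂ (φ x) * Q (x, y) ∂μ := by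
  -- both sides are compared by pairing with `φ ⊗ 1_s` for sets `s` of finite measure
  have key : ∀ s : Set Y, MeasurableSet s → ν s < ⊤ →
      Integrable (fun p : X × Y => starRingEnd ℂ (φ p.1) * Q p) ((μ.prod ν).restrict
        (Set.univ ×ˢ s)) ∧
      ∫ y in s, (tensorOp (ν := ν) φ).adjoint Q y ∂ν =
        ∫ y in s, ∫ x, starRingEnd ℂ (φ x) * Q (x, y) ∂μ ∂ν := by
    intro s hs hνs
    have hind : MemLp (s.indicator fun _ => (1 : ℂ)) 2 ν :=
      memLp_indicator_const 2 hs 1 (Or.inr hνs.ne)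
    have hT : MemLp (fun p : X × Y => φ p.1 * s.indicator (fun _ => (1 : ℂ)) p.2) 2 (μ.prod ν) :=
      memLp_tensor (Lp.memLp φ) hind
    have hEq : (Set.univ ×ˢ s).indicator (fun p : X × Y => starRingEnd ℂ (φ p.1) * Q p) =
        fun p => star (φ p.1 * s.indicator (fun _ => (1 : ℂ)) p.2) * Q p := by
      ext1 p
      by_cases hp : p.2 ∈ s <;> simp [hp]
    have hms : MeasurableSet (Set.univ ×ˢ s : Set (X × Y)) := MeasurableSet.univ.prod hs
    have hint : Integrable (fun p : X × Y => starRingEnd ℂ (φ p.1) * Q p) ((μ.prod ν).restrict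
        (Set.univ ×ˢ s)) := by
      rw [← IntegrableOn, ← integrable_indicator_iff hms, hEq]
      exact hT.star.integrable_mul (Lp.memLp Q)
    refine ⟨hint, ?_⟩
    rw [← L2.inner_indicatorConstLp_one (𝕜 := ℂ) hs hνs.ne, ContinuousLinearMap.adjoint_inner_right,
      L2.inner_def]
    have h1 : (tensorOp (ν := ν) φ) (indicatorConstLp 2 hs hνs.ne 1) =ᵐ[μ.prod ν]
        fun p => φ p.1 * s.indicator (fun _ => (1 : ℂ)) p.2 := by
      refine (MemLp.coeFn_toLp (memLp_tensor (Lp.memLp φ)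
        (Lp.memLp (indicatorConstLp 2 hs hνs.ne (1 : ℂ))))).trans ?_
      filter_upwards [Measure.quasiMeasurePreserving_snd.ae
        (indicatorConstLp_coeFn (p := 2) (hs := hs) (hμs := hνs.ne) (c := (1 : ℂ)))] with p hp
      rw [hp]
    have h2 : ∫ p, inner ℂ ((tensorOp (ν := ν) φ) (indicatorConstLp 2 hs hνs.ne 1) p) (Q p)
        ∂μ.prod ν = ∫ p in Set.univ ×ˢ s, starRingEnd ℂ (φ p.1) * Q p ∂μ.prod ν := by
      rw [← integral_indicator hms, hEq]
      refine integral_congr_ae ?_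
      filter_upwards [h1] with p hp
      rw [hp, RCLike.inner_apply, mul_comm]
      rfl
    rw [h2]
    rw [← Measure.prod_restrict, Measure.restrict_univ] at hint ⊢
    rw [integral_prod_symm _ hint]
  refine ae_eq_of_forall_setIntegral_eq_of_sigmaFinite (fun s hs hνs => ?_) (fun s hs hνs => ?_)
    (fun s hs hνs => (key s hs hνs).2)
  · exact integrableOn_Lp_of_measure_ne_top _ (by norm_num) hνs.ne
  · have h := (key s hs hνs).1
    rw [← Measure.prod_restrict, Measure.restrict_univ] at h
    exact h.integral_prod_right

lemma mulOp_ae {X : Type*} [MeasurableSpace X] {μ : Measure X} {m : X → ℂ} (hm : MemLp m ⊤ μ)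
    (h : Lp ℂ 2 μ) : mulOp m hm h =ᵐ[μ] fun x => m x * h x := by
  refine ((ContinuousLinearMap.mul ℂ ℂ).coeFn_holder (hm.toLp m) h).trans ?_
  filter_upwards [hm.coeFn_toLp] with x hx
  simp [hx]

/-- The action of a rotation on the displacement momentum, at fixed center-of-mass momentum. -/
def rotFst {n : ℕ} (p : (Mom n × Mom n) × rotGroup n) : Mom n × Mom n :=
  (act (rotMat p.2) p.1.1, p.1.2)

lemma measurable_rotFst (n : ℕ) : Measurable (rotFst (n := n)) :=
  ((continuous_act ((continuous_rotMat n).comp continuous_snd)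
    (continuous_fst.comp continuous_fst)).prodMk
      (continuous_snd.comp continuous_fst)).measurable

lemma measurePreserving_rotFst (n : ℕ) :
    MeasurePreserving (rotFst (n := n)) ((volume : Measure (Mom n × Mom n)).prod (rotHaar n))
      (volume : Measure (Mom n × Mom n)) := by
  refine ⟨measurable_rotFst n, Measure.ext fun s hs => ?_⟩
  rw [Measure.map_apply (measurable_rotFst n) hs, Measure.prod_apply_symm (measurable_rotFst n hs)]
  have h : ∀ σ, volume ((fun q => (q, σ)) ⁻¹' (rotFst (n := n) ⁻¹' s)) = volume s := fun σ =>
    ((rotIso σ).measurePreserving.prod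
      (MeasurePreserving.id volume)).measure_preimage hs.nullMeasurableSet
  simp only [h, lintegral_const, measure_univ, mul_one]

/-- The integrand of the quadratic form of `S(r) ⊗ |φ⟩⟨φ|` with the projection onto constants on the
sphere written as an average over rotations. -/
def cmIntegrand {n : ℕ} (α₀ l₀ lam : ℝ) (F G : Mom n × Mom n → ℂ)
    (p : (Mom n × Mom n) × rotGroup n) : ℂ :=
  scatCoeff n α₀ l₀ lam ‖p.1.1‖ * (starRingEnd ℂ (G p.1) * F (rotFst p))

lemma integrable_cmIntegrand {n : ℕ} (α₀ l₀ lam : ℝ) {F G : Mom n × Mom n → ℂ}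
    (hF : MemLp F 2 volume) (hG : MemLp G 2 volume) :
    Integrable (cmIntegrand α₀ l₀ lam F G) (volume.prod (rotHaar n)) := by
  have h1 : MemLp (fun p : (Mom n × Mom n) × rotGroup n => G p.1) 2 (volume.prod (rotHaar n)) :=
    hG.comp_measurePreserving measurePreserving_fst
  have h2 := hF.comp_measurePreserving (measurePreserving_rotFst n)
  exact (h1.star.integrable_mul h2).bdd_mul (c := 2)
    ((measurable_scatCoeff n α₀ l₀ lam).comp (by fun_prop)).aestronglyMeasurable
    (Filter.Eventually.of_forall fun _ => norm_scatCoeff_le _ _ _ _ _)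

lemma rotFst_polarMap {n : ℕ} (σ : rotGroup n) (p : Sph n × (Set.Ioi (0 : ℝ) × Mom n)) :
    rotFst (polarMap n p, σ) = polarMap n (rotSph σ p.1, p.2) := by
  simp [rotFst, polarMap, rotSph]

lemma norm_polarMap_fst {n : ℕ} (p : Sph n × (Set.Ioi (0 : ℝ) × Mom n)) :
    ‖(polarMap n p).1‖ = p.2.1 := by
  simp [polarMap, norm_smul, abs_of_pos (Set.mem_Ioi.1 p.2.1.2)]

/-- The operator `T† P`, with `T = φ ⊗ ·` and `P` the passage to polar coordinates, integrates over
the sphere. -/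
lemma adjoint_tensorOp_polarOp_ae (n : ℕ) [NeZero n] {F : Mom n × Mom n → ℂ}
    (hF : MemLp F 2 volume) :
    (tensorOp (ν := radMeasure n) (sphConst n)).adjoint (polarOp n (hF.toLp F)) =ᵐ[radMeasure n]
      fun y => ((((sphMeasure n).real Set.univ) ^ (-(1 / 2) : ℝ) : ℝ) : ℂ) *
        ∫ ω, F (polarMap n (ω, y)) ∂sphMeasure n := by
  refine (adjoint_tensorOp_ae _ _).trans ?_
  have h1 : polarOp n (hF.toLp F) =
      (hF.comp_measurePreserving (measurePreserving_polarMap n)).toLp _ :=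
    Lp.toLp_compMeasurePreserving hF (measurePreserving_polarMap n)
  have h2 : polarOp n (hF.toLp F) =ᵐ[(sphMeasure n).prod (radMeasure n)] F ∘ polarMap n := by
    rw [h1]
    exact MemLp.coeFn_toLp _
  have h3 : ∀ᵐ y ∂radMeasure n, ∀ᵐ ω ∂sphMeasure n,
      polarOp n (hF.toLp F) (ω, y) = F (polarMap n (ω, y)) :=
    Measure.ae_ae_of_ae_prod (Measure.measurePreserving_swap.quasiMeasurePreserving.ae h2)
  have h4 : sphConst n =ᵐ[sphMeasure n] fun _ =>
      ((((sphMeasure n).real Set.univ) ^ (-(1 / 2) : ℝ) : ℝ) : ℂ) := by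
    refine indicatorConstLp_coeFn.trans ?_
    rw [Set.indicator_univ]
  filter_upwards [h3] with y hy
  rw [← integral_const_mul]
  refine integral_congr_ae ?_
  filter_upwards [hy, h4] with ω h5 h6
  rw [h5, h6, Complex.conj_ofReal]

set_option maxHeartbeats 400000 in
/-- The quadratic form of `S(r) ⊗ |φ⟩⟨φ| ⊗ I_cm` as an average over rotations of the displacement
momentum. -/
lemma inner_scatOpCM (n : ℕ) [NeZero n] (α₀ l₀ lam : ℝ) {F G : Mom n × Mom n → ℂ}
    (hF : MemLp F 2 volume) (hG : MemLp G 2 volume) :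
    inner ℂ (hG.toLp G) (scatOpCM n α₀ l₀ lam (hF.toLp F) - hF.toLp F) =
      ∫ p, cmIntegrand α₀ l₀ lam F G p ∂(volume : Measure (Mom n × Mom n)).prod (rotHaar n) := by
  have hJ := integrable_cmIntegrand α₀ l₀ lam hF hG
  have hP := measurePreserving_polarMap n
  have hmem := hF.comp_measurePreserving hP
  have hE : scatOpCM n α₀ l₀ lam (hF.toLp F) - hF.toLp F =
      (polarOp n).adjoint (tensorOp (sphConst n) (mulOp _ (memLp_scatCoeff n α₀ l₀ lam)
        ((tensorOp (sphConst n)).adjoint (polarOp n (hF.toLp F))))) := by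
    simp [scatOpCM]
  have haesm : ∀ᵐ y ∂radMeasure n,
      AEStronglyMeasurable (fun ω => F (polarMap n (ω, y))) (sphMeasure n) :=
    hmem.1.prod_swap.prodMk_left
  have hpos : 0 < (sphMeasure n).real Set.univ := by
    rw [measureReal_def, ENNReal.toReal_pos_iff, pos_iff_ne_zero, Ne, Measure.measure_univ_eq_zero]
    exact ⟨Measure.toSphere_ne_zero _, measure_lt_top _ _⟩
  -- the normalization of `φ` turns the product of two sphere integrals into one average
  have hc : ((sphMeasure n).real Set.univ) ^ (-(1 / 2) : ℝ) *
      ((sphMeasure n).real Set.univ) ^ (-(1 / 2) : ℝ) = ((sphMeasure n).real Set.univ)⁻¹ := by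
    rw [← Real.rpow_add hpos, ← Real.rpow_neg_one]
    norm_num
  have hI : Integrable (fun x : Sph n × (Set.Ioi (0 : ℝ) × Mom n) =>
      ∫ σ, cmIntegrand α₀ l₀ lam F G (polarMap n x, σ) ∂rotHaar n)
      ((sphMeasure n).prod (radMeasure n)) :=
    hP.integrable_comp_of_integrable hJ.integral_prod_left
  rw [hE, ContinuousLinearMap.adjoint_inner_right, ← ContinuousLinearMap.adjoint_inner_left,
    L2.inner_def, integral_prod _ hJ]
  -- polar coordinates in the displacement momentum
  have hpol : ∫ q, ∫ σ, cmIntegrand α₀ l₀ lam F G (q, σ) ∂rotHaar n =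
      ∫ y, ∫ ω, ∫ σ, cmIntegrand α₀ l₀ lam F G (polarMap n (ω, y), σ) ∂rotHaar n
        ∂sphMeasure n ∂radMeasure n := by
    rw [← integral_prod_symm _ hI, ← integral_map (φ := polarMap n)
      (f := fun q => ∫ σ, cmIntegrand α₀ l₀ lam F G (q, σ) ∂rotHaar n)
      hP.measurable.aemeasurable (by rw [hP.map_eq]; exact hJ.integral_prod_left.1), hP.map_eq]
  rw [hpol]
  refine integral_congr_ae ?_
  filter_upwards [adjoint_tensorOp_polarOp_ae n hF, adjoint_tensorOp_polarOp_ae n hG,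
    mulOp_ae (memLp_scatCoeff n α₀ l₀ lam)
      ((tensorOp (sphConst n)).adjoint (polarOp n (hF.toLp F))), haesm] with y h1 h2 h3 h4
  have h5 : ∀ ω : Sph n, ∫ σ, cmIntegrand α₀ l₀ lam F G (polarMap n (ω, y), σ) ∂rotHaar n =
      starRingEnd ℂ (G (polarMap n (ω, y))) * (scatCoeff n α₀ l₀ lam y.1 *
        (((sphMeasure n).real Set.univ)⁻¹ • ∫ x, F (polarMap n (x, y)) ∂sphMeasure n)) := by
    intro ω
    simp only [cmIntegrand, rotFst_polarMap, norm_polarMap_fst]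
    rw [integral_const_mul, integral_const_mul,
      integral_rotSph ω (h := fun x => F (polarMap n (x, y))) h4]
    ring
  simp only [h5]
  rw [integral_mul_const, integral_conj, RCLike.inner_apply, h3, h1, h2, ← hc, map_mul,
    Complex.conj_ofReal, Complex.real_smul]
  push_cast
  ring

/-! ### Change of variables along rescaling maps -/

/-- A measurable family of maps `Θ (·, r)` of `Q`, each of which pushes `μ` forward to `c r • μ`,
changes variables in an integral over `Q × R` with density `(c r)⁻¹`. -/
lemma integral_comp_fiberwise {Q R : Type*} [MeasurableSpace Q] [MeasurableSpace R] {μ : Measure Q}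
    {ρ : Measure R} [SFinite μ] [SFinite ρ] {Θ : Q × R → Q} (hΘ : Measurable Θ) {c : R → ℝ}
    (hc : Measurable c) (hc0 : ∀ r, 0 < c r)
    (hmap : ∀ r, μ.map (fun q => Θ (q, r)) = ENNReal.ofReal (c r) • μ) {J : Q × R → ℂ}
    (hJ : Integrable J (μ.prod ρ)) :
    Integrable (fun p : Q × R => (((c p.2)⁻¹ : ℝ) : ℂ) * J (Θ p, p.2)) (μ.prod ρ) ∧
      ∫ p, (((c p.2)⁻¹ : ℝ) : ℂ) * J (Θ p, p.2) ∂μ.prod ρ = ∫ p, J p ∂μ.prod ρ := by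
  set w : Q × R → NNReal := fun p => Real.toNNReal (c p.2)⁻¹ with hw
  have hwm : Measurable w := by fun_prop
  have hwe : Measurable fun p => (w p : ENNReal) := hwm.coe_nnreal_ennreal
  have hΨ : Measurable fun p : Q × R => (Θ p, p.2) := hΘ.prodMk measurable_snd
  have hMP : MeasurePreserving (fun p : Q × R => (Θ p, p.2))
      ((μ.prod ρ).withDensity fun p => w p) (μ.prod ρ) := by
    refine ⟨hΨ, Measure.ext fun s hs => ?_⟩
    rw [Measure.map_apply hΨ hs, withDensity_apply _ (hΨ hs), ← lintegral_indicator (hΨ hs),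
      lintegral_prod_symm' _ (hwe.indicator (hΨ hs)), Measure.prod_apply_symm hs]
    refine lintegral_congr fun r => ?_
    have hsr : MeasurableSet ((fun q => (q, r)) ⁻¹' s) := measurable_prodMk_right hs
    have hΘr : Measurable fun q => Θ (q, r) := hΘ.comp measurable_prodMk_right
    have h1 : ∀ q, ((fun p : Q × R => (Θ p, p.2)) ⁻¹' s).indicator
        (fun p => (w p : ENNReal)) (q, r) =
        ((fun q => Θ (q, r)) ⁻¹' ((fun q => (q, r)) ⁻¹' s)).indicator
          (fun _ => ENNReal.ofReal (c r)⁻¹) q := fun q => rfl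
    simp only [h1]
    rw [lintegral_indicator_const (hΘr hsr), ← Measure.map_apply hΘr hsr, hmap, Measure.smul_apply,
      smul_eq_mul, ← mul_assoc, ← ENNReal.ofReal_mul (inv_nonneg.2 (hc0 r).le),
      inv_mul_cancel₀ (hc0 r).ne', ENNReal.ofReal_one, one_mul]
  have hsm : ∀ p : Q × R, w p • J (Θ p, p.2) = (((c p.2)⁻¹ : ℝ) : ℂ) * J (Θ p, p.2) := by
    intro p
    rw [NNReal.smul_def, hw, Real.coe_toNNReal _ (inv_nonneg.2 (hc0 _).le), Complex.real_smul]
  constructor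
  · have h := hMP.integrable_comp_of_integrable hJ
    rw [integrable_withDensity_iff_integrable_smul hwm] at h
    simpa only [hsm, Function.comp_apply] using h
  · have hJm : AEStronglyMeasurable J (((μ.prod ρ).withDensity fun p => w p).map
        fun p : Q × R => (Θ p, p.2)) := by
      rw [hMP.map_eq]
      exact hJ.1
    simp only [← hsm]
    rw [← integral_withDensity_eq_integral_smul hwm, ← integral_map hΨ.aemeasurable hJm, hMP.map_eq]

lemma measurePreserving_shear_snd {n : ℕ} (A : Mom n →ₗ[ℝ] Mom n) :
    MeasurePreserving (fun q : Mom n × Mom n => (q.1, q.2 + A q.1)) := by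
  have hA : Continuous A := A.continuous_of_finiteDimensional
  have hm : Measurable (Function.uncurry fun (k K : Mom n) => K + A k) :=
    (continuous_snd.add (hA.comp continuous_fst)).measurable
  exact (MeasurePreserving.id volume).skew_product hm
    (Filter.Eventually.of_forall fun k => map_add_right_eq_self _ _)

lemma measurePreserving_shear_fst {n : ℕ} (t : ℝ) :
    MeasurePreserving (fun q : Mom n × Mom n => (q.1 - t • q.2, q.2)) := by
  have h1 := measurePreserving_shear_snd (n := n) (-t • LinearMap.id)
  have h2 := (Measure.measurePreserving_swap.comp h1).comp
    (Measure.measurePreserving_swap (μ := (volume : Measure (Mom n)))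
      (ν := (volume : Measure (Mom n))))
  have h3 : (fun q : Mom n × Mom n => (q.1 - t • q.2, q.2)) =
      (Prod.swap ∘ fun q : Mom n × Mom n =>
        (q.1, q.2 + (-t • LinearMap.id : Mom n →ₗ[ℝ] Mom n) q.1))
        ∘ Prod.swap := by
    ext1 q
    simp [sub_eq_add_neg]
  rw [h3]
  exact h2

/-- At fixed light momentum `k`, the map `K ↦ (1 + λ) (K + σ k)` from the heavy momentum to the
center-of-mass momentum pushes Lebesgue measure to `(1 + λ) ^ (-n)` times itself. -/
lemma map_totalMom {n : ℕ} {lam : ℝ} (hlam : 0 < lam) (σ : rotGroup n) :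
    (volume : Measure (Mom n × Mom n)).map
        (fun q => (q.1, (1 + lam) • (q.2 + act (rotMat σ) q.1))) =
      ENNReal.ofReal (((1 + lam) ^ n)⁻¹) • volume := by
  have h0 : (1 + lam) ≠ 0 := by positivity
  have h1 : Measurable (Prod.map id fun v : Mom n => (1 + lam) • v :
      Mom n × Mom n → Mom n × Mom n) := by fun_prop
  have h2 := measurePreserving_shear_snd (Matrix.toEuclideanLin (rotMat σ))
  change Measure.map ((Prod.map id fun v : Mom n => (1 + lam) • v) ∘
    fun q : Mom n × Mom n => (q.1, q.2 + Matrix.toEuclideanLin (rotMat σ) q.1)) volume = _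
  rw [← Measure.map_map h1 h2.measurable, h2.map_eq, Measure.volume_eq_prod,
    ← Measure.map_prod_map _ _ measurable_id (by fun_prop), Measure.map_id,
    Measure.map_addHaar_smul _ h0, finrank_euclideanSpace_fin, Measure.prod_smul_right,
    abs_of_pos (by positivity)]

/-- At fixed heavy momentum `K`, the map `k ↦ M⁻¹ (k - t K)` pushes Lebesgue measure to
`det M` times itself. -/
lemma map_act_shear {n : ℕ} {M : Matrix (Fin n) (Fin n) ℝ} (hM : 0 < M.det) (t : ℝ) :
    (volume : Measure (Mom n × Mom n)).map (fun q => (act M⁻¹ (q.1 - t • q.2), q.2)) =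
      ENNReal.ofReal M.det • volume := by
  have hdet : LinearMap.det (Matrix.toEuclideanLin M⁻¹) = M.det⁻¹ := by
    rw [LinearMap.det_toLpLin, Matrix.det_nonsing_inv, Ring.inverse_eq_inv']
  have hA : Measurable (Matrix.toEuclideanLin M⁻¹) :=
    (LinearMap.continuous_of_finiteDimensional _).measurable
  have h2 := measurePreserving_shear_fst (n := n) t
  change Measure.map ((Prod.map (Matrix.toEuclideanLin M⁻¹) id) ∘
    fun q : Mom n × Mom n => (q.1 - t • q.2, q.2)) volume = _
  rw [← Measure.map_map (hA.prodMap measurable_id) h2.measurable, h2.map_eq,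
    Measure.volume_eq_prod, ← Measure.map_prod_map _ _ hA measurable_id, Measure.map_id,
    Measure.map_linearMap_addHaar_eq_smul_addHaar _ (by rw [hdet]; positivity), hdet, inv_inv,
    abs_of_pos hM, Measure.prod_smul_left]

/-! ### Positivity of the Jacobian -/

/-- For an orthogonal matrix `M` and `0 ≤ t < 1` the matrix `1 + t M` is injective, hence along the
segment from `0` to `t` its determinant does not change sign. -/
lemma det_one_add_smul_pos_of_lt_one {n : ℕ} {M : Matrix (Fin n) (Fin n) ℝ}
    (hM : M ∈ Matrix.unitaryGroup (Fin n) ℝ) {t : ℝ} (ht0 : 0 ≤ t) (ht1 : t < 1) :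
    0 < (1 + t • M).det := by
  have hne : ∀ s ∈ Set.Icc 0 t, (1 + s • M).det ≠ 0 := by
    intro s hs h0
    obtain ⟨v, hv, hv0⟩ := Matrix.exists_mulVec_eq_zero_iff.2 h0
    have h1 : act (1 + s • M) (WithLp.toLp 2 v) = 0 := by
      rw [act, Matrix.toLpLin_toLp, Matrix.toLin'_apply, hv0]
      rfl
    rw [act_one_add_smul] at h1
    have h2 : ‖WithLp.toLp 2 v‖ = s * ‖WithLp.toLp 2 v‖ := by
      conv_lhs => rw [eq_neg_of_add_eq_zero_left h1]
      rw [norm_neg, norm_smul, norm_act_of_mem_unitaryGroup hM, Real.norm_of_nonneg hs.1]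
    have h3 : 0 < ‖(WithLp.toLp 2 v : Mom n)‖ := by
      rw [norm_pos_iff]
      simpa using hv
    nlinarith [hs.2]
  have hcont : Continuous fun s : ℝ => (1 + s • M).det :=
    Continuous.matrix_det (by fun_prop)
  by_contra hneg
  obtain ⟨s, hs, hs0⟩ := intermediate_value_Icc' ht0 hcont.continuousOn
    (show (0 : ℝ) ∈ Set.Icc _ _ from ⟨not_lt.1 hneg, by simp⟩)
  exact hne s hs hs0

lemma det_one_add_smul_pos_of_one_lt {n : ℕ} {M : Matrix (Fin n) (Fin n) ℝ}
    (hM : M ∈ Matrix.unitaryGroup (Fin n) ℝ) (hdet : M.det = 1) {t : ℝ} (ht : 1 < t) :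
    0 < (1 + t • M).det := by
  have ht0 : 0 < t := by linarith
  -- `M` is invertible with inverse `star M`, which reduces `t` to `t⁻¹ < 1`
  have h1 : 1 + t • M = (t • M) * (1 + t⁻¹ • star M) := by
    rw [mul_add, mul_one, Matrix.smul_mul, Matrix.mul_smul, (Unitary.mem_iff.1 hM).2, smul_smul,
      mul_inv_cancel₀ ht0.ne', one_smul, add_comm]
  rw [h1, Matrix.det_mul, Matrix.det_smul, hdet]
  have := det_one_add_smul_pos_of_lt_one (Unitary.star_mem hM) (inv_nonneg.2 ht0.le)
    (inv_lt_one_of_one_lt₀ ht)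
  positivity

lemma det_one_add_smul_rotMat_pos {n : ℕ} {lam : ℝ} (hlam : 0 < lam)
    (h : lam < 1 ∨ (1 < lam ∧ n ≠ 1)) (σ : rotGroup n) : 0 < (1 + lam • rotMat σ).det := by
  rcases h with h | ⟨h, hn⟩
  · exact det_one_add_smul_pos_of_lt_one σ.1.2 hlam.le h
  · exact det_one_add_smul_pos_of_one_lt σ.1.2 (σ.2.resolve_left hn) h

/-! ### The scattering operator in the momenta of the two particles -/

/-- The measurable equivalence `cmCoord`, with inverse
`(k_d, K_cm) ↦ (k_d + λ/(1+λ) K_cm, K_cm/(1+λ) - k_d)`. -/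
def cmEquiv (n : ℕ) {lam : ℝ} (hlam : 0 < lam) : Mom n × Mom n ≃ᵐ Mom n × Mom n where
  toFun := cmCoord n lam
  invFun q := (q.1 + (lam / (1 + lam)) • q.2, (1 / (1 + lam)) • q.2 - q.1)
  left_inv q := by
    have h : (1 : ℝ) / (1 + lam) = 1 - lam / (1 + lam) := by field_simp; ring
    ext1 <;> simp only [cmCoord, h] <;> module
  right_inv q := by
    have h : (1 : ℝ) / (1 + lam) = 1 - lam / (1 + lam) := by field_simp; ring
    ext1 <;> simp only [cmCoord, h] <;> module
  measurable_toFun := (measurePreserving_cmCoord n hlam).measurable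
  measurable_invFun := by
    simp only [Equiv.coe_fn_symm_mk]
    fun_prop

lemma cmEquiv_symm_apply (n : ℕ) {lam : ℝ} (hlam : 0 < lam) (q : Mom n × Mom n) :
    (cmEquiv n hlam).symm q = (q.1 + (lam / (1 + lam)) • q.2, (1 / (1 + lam)) • q.2 - q.1) := rfl

lemma memLp_comp_cmEquiv_symm {n : ℕ} {lam : ℝ} (hlam : 0 < lam) {f : Mom n × Mom n → ℂ}
    (hf : MemLp f 2 volume) : MemLp (f ∘ (cmEquiv n hlam).symm) 2 volume :=
  hf.comp_measurePreserving ((measurePreserving_cmCoord n hlam).symm (cmEquiv n hlam))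

lemma cmOp_toLp {n : ℕ} {lam : ℝ} (hlam : 0 < lam) {f : Mom n × Mom n → ℂ}
    (hf : MemLp f 2 volume) :
    cmOp n hlam ((memLp_comp_cmEquiv_symm hlam hf).toLp _) = hf.toLp f := by
  refine (Lp.toLp_compMeasurePreserving (memLp_comp_cmEquiv_symm hlam hf)
    (measurePreserving_cmCoord n hlam)).trans (MemLp.toLp_congr _ _ ?_)
  refine Filter.Eventually.of_forall fun q => ?_
  exact congrArg f ((cmEquiv n hlam).symm_apply_apply q)

lemma inner_cmOp {n : ℕ} {lam : ℝ} (hlam : 0 < lam) (u v : TwoBody n) :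
    inner ℂ (cmOp n hlam u) (cmOp n hlam v) = inner ℂ u v :=
  (Lp.compMeasurePreservingₗᵢ ℂ (cmCoord n lam)
    (measurePreserving_cmCoord n hlam)).inner_map_map u v

lemma adjoint_cmOp_cmOp {n : ℕ} {lam : ℝ} (hlam : 0 < lam) (u : TwoBody n) :
    (cmOp n hlam).adjoint (cmOp n hlam u) = u :=
  ext_inner_left ℂ fun v => by rw [ContinuousLinearMap.adjoint_inner_right, inner_cmOp]

/-- The matrix elements of `A_λ`, written in the variables `(k_d, K_cm)`. -/
lemma inner_opA {n : ℕ} [NeZero n] (α₀ l₀ : ℝ) {lam : ℝ} (hlam : 0 < lam)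
    {f g : Mom n × Mom n → ℂ} (hf : MemLp f 2 volume) (hg : MemLp g 2 volume) :
    inner ℂ (hg.toLp g) (opA n α₀ l₀ hlam (hf.toLp f)) =
      ∫ p, cmIntegrand α₀ l₀ lam (f ∘ (cmEquiv n hlam).symm) (g ∘ (cmEquiv n hlam).symm) p
        ∂(volume : Measure (Mom n × Mom n)).prod (rotHaar n) := by
  rw [← inner_scatOpCM n α₀ l₀ lam (memLp_comp_cmEquiv_symm hlam hf)
    (memLp_comp_cmEquiv_symm hlam hg), ← inner_cmOp hlam (MemLp.toLp (g ∘ _) _),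
    map_sub, cmOp_toLp, cmOp_toLp]
  have h : opA n α₀ l₀ hlam (hf.toLp f) =
      cmOp n hlam (scatOpCM n α₀ l₀ lam ((cmOp n hlam).adjoint (hf.toLp f))) - hf.toLp f := rfl
  have h2 : (cmOp n hlam).adjoint (hf.toLp f) = (memLp_comp_cmEquiv_symm hlam hf).toLp _ := by
    conv_lhs => rw [← cmOp_toLp hlam hf]
    exact adjoint_cmOp_cmOp hlam _
  rw [h, h2]

/-- Substituting `K_cm = (1 + λ) (K + σ k)` in the integrand in center-of-mass variables gives the
integrand of the first representation. -/
lemma cmIntegrand_totalMom {n : ℕ} (α₀ l₀ : ℝ) {lam : ℝ} (hlam : 0 < lam)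
    (f g : Mom n × Mom n → ℂ) (q : Mom n × Mom n) (σ : rotGroup n) :
    cmIntegrand α₀ l₀ lam (f ∘ (cmEquiv n hlam).symm) (g ∘ (cmEquiv n hlam).symm)
      ((q.1, (1 + lam) • (q.2 + act (rotMat σ) q.1)), σ) = formIntegrand₁ α₀ l₀ lam f g q σ := by
  have h0 : 1 + lam ≠ 0 := by positivity
  simp only [cmIntegrand, formIntegrand₁, rotFst, Function.comp_apply, cmEquiv_symm_apply,
    smul_smul, div_mul_cancel₀ _ h0, one_smul, act_sub_one, add_sub_assoc, sub_self, add_zero,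
    mul_assoc]

lemma continuous_matrix_inv {X : Type*} [TopologicalSpace X] {n : ℕ}
    {M : X → Matrix (Fin n) (Fin n) ℝ} (hM : Continuous M) (h0 : ∀ x, (M x).det ≠ 0) :
    Continuous fun x => (M x)⁻¹ := by
  simp only [Matrix.inv_def, Ring.inverse_eq_inv']
  exact (hM.matrix_det.inv₀ h0).smul hM.matrix_adjugate

/-- Substituting `(1 + λ σ)⁻¹ (k - λ K)` for `k` in the integrand of the first representation gives
the integrand of the second, up to the Jacobian. -/
lemma formIntegrand₁_act_inv {n : ℕ} (α₀ l₀ lam : ℝ) (f g : Mom n × Mom n → ℂ)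
    (q : Mom n × Mom n) (σ : rotGroup n) (hdet : (1 + lam • rotMat σ).det ≠ 0) :
    ((((1 + lam • rotMat σ).det)⁻¹ : ℝ) : ℂ) * formIntegrand₁ α₀ l₀ lam f g
      (act (1 + lam • rotMat σ)⁻¹ (q.1 - lam • q.2), q.2) σ =
      formIntegrand₂ α₀ l₀ lam f g q σ := by
  have h1 : act (1 + lam • rotMat σ) (act (1 + lam • rotMat σ)⁻¹ (q.1 - lam • q.2)) =
      q.1 - lam • q.2 := by
    rw [← act_mul, Matrix.mul_nonsing_inv _ (isUnit_iff_ne_zero.2 hdet), act_one]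
  simp only [formIntegrand₁, formIntegrand₂, act_mul, act_sub_one]
  set κ := act (1 + lam • rotMat σ)⁻¹ (q.1 - lam • q.2)
  rw [act_one_add_smul] at h1
  have h2 : κ + lam • (q.2 + act (rotMat σ) κ) = q.1 := by
    rw [smul_add, add_left_comm, h1]
    abel
  have h3 : act (rotMat σ) κ + lam • (q.2 + act (rotMat σ) κ) = q.1 + (act (rotMat σ) κ - κ) := by
    rw [← h2]
    abel
  rw [h2, h3, Complex.ofReal_inv]
  ring

end PointScattering

end

/-! ### The two representations -/

theorem mainTheorem4 (n : ℕ) [NeZero n] (hn : n ≤ 3) (α₀ l₀ lam : ℝ) (hl₀ : l₀ ≠ 0)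
    (hlam : 0 < lam) (f g : PointScattering.Mom n × PointScattering.Mom n → ℂ)
    (hf : MemLp f 2 volume) (hg : MemLp g 2 volume) :
    (Integrable (fun p : (PointScattering.Mom n × PointScattering.Mom n) ×
          PointScattering.rotGroup n =>
        PointScattering.formIntegrand₁ α₀ l₀ lam f g p.1 p.2)
        (volume.prod (PointScattering.rotHaar n)) ∧
      inner ℂ (hg.toLp g) (PointScattering.opA n α₀ l₀ hlam (hf.toLp f)) =
        (((1 + lam) ^ n : ℝ) : ℂ) * ∫ q : PointScattering.Mom n × PointScattering.Mom n,
          ∫ σ : PointScattering.rotGroup n,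
            PointScattering.formIntegrand₁ α₀ l₀ lam f g q σ ∂PointScattering.rotHaar n) ∧
    (lam < 1 ∨ (1 < lam ∧ n ≠ 1) →
      Integrable (fun p : (PointScattering.Mom n × PointScattering.Mom n) ×
          PointScattering.rotGroup n =>
        PointScattering.formIntegrand₂ α₀ l₀ lam f g p.1 p.2)
        (volume.prod (PointScattering.rotHaar n)) ∧
      inner ℂ (hg.toLp g) (PointScattering.opA n α₀ l₀ hlam (hf.toLp f)) =
        (((1 + lam) ^ n : ℝ) : ℂ) * ∫ q : PointScattering.Mom n × PointScattering.Mom n,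
          ∫ σ : PointScattering.rotGroup n,
            PointScattering.formIntegrand₂ α₀ l₀ lam f g q σ ∂PointScattering.rotHaar n) := by
  have hJ := PointScattering.integrable_cmIntegrand α₀ l₀ lam
    (PointScattering.memLp_comp_cmEquiv_symm hlam hf)
    (PointScattering.memLp_comp_cmEquiv_symm hlam hg)
  have hpow : (((1 + lam) ^ n : ℝ) : ℂ) ≠ 0 := by
    rw [Ne, Complex.ofReal_eq_zero]
    positivity
  -- first substitution: `K_cm = (1 + λ) (K + σ k)`
  have hΘ₁ : Measurable fun p : (PointScattering.Mom n × PointScattering.Mom n) ×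
      PointScattering.rotGroup n => (p.1.1, (1 + lam) •
        (p.1.2 + PointScattering.act (PointScattering.rotMat p.2) p.1.1)) := by
    have h := PointScattering.continuous_act
      ((PointScattering.continuous_rotMat n).comp continuous_snd)
      ((continuous_fst (X := PointScattering.Mom n) (Y := PointScattering.Mom n)).comp
        (continuous_fst (Y := PointScattering.rotGroup n)))
    exact ((continuous_fst.comp continuous_fst).prodMk
      (((continuous_snd.comp continuous_fst).add h).const_smul (1 + lam))).measurable
  have h₁ := PointScattering.integral_comp_fiberwise hΘ₁
    (c := fun _ => ((1 + lam) ^ n)⁻¹) measurable_const (fun _ => by positivity)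
    (fun σ => PointScattering.map_totalMom hlam σ) hJ
  simp only [inv_inv, PointScattering.cmIntegrand_totalMom] at h₁
  have hint₁ : Integrable (fun p : (PointScattering.Mom n × PointScattering.Mom n) ×
      PointScattering.rotGroup n => PointScattering.formIntegrand₁ α₀ l₀ lam f g p.1 p.2)
      (volume.prod (PointScattering.rotHaar n)) := by
    have h := h₁.1.const_mul ((((1 + lam) ^ n : ℝ) : ℂ)⁻¹)
    simpa only [inv_mul_cancel_left₀ hpow] using h
  have heq₁ := PointScattering.inner_opA α₀ l₀ hlam hf hg
  rw [← h₁.2, integral_const_mul] at heq₁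
  refine ⟨⟨hint₁, ?_⟩, fun hcase => ?_⟩
  · rw [heq₁, integral_prod _ hint₁]
  · have hdet := PointScattering.det_one_add_smul_rotMat_pos (n := n) hlam hcase
    have hM : Continuous fun σ : PointScattering.rotGroup n =>
        1 + lam • PointScattering.rotMat σ :=
      continuous_const.add ((PointScattering.continuous_rotMat n).const_smul lam)
    -- second substitution: `k` becomes `(1 + λ σ)⁻¹ (k - λ K)`
    have hΘ₂ : Measurable fun p : (PointScattering.Mom n × PointScattering.Mom n) ×
        PointScattering.rotGroup n => (PointScattering.act (1 + lam • PointScattering.rotMat p.2)⁻¹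
          (p.1.1 - lam • p.1.2), p.1.2) := by
      have h := PointScattering.continuous_act
        ((PointScattering.continuous_matrix_inv hM fun σ => (hdet σ).ne').comp continuous_snd)
        (((continuous_fst (X := PointScattering.Mom n) (Y := PointScattering.Mom n)).sub
          (continuous_snd.const_smul lam)).comp (continuous_fst (Y := PointScattering.rotGroup n)))
      exact (h.prodMk (continuous_snd.comp continuous_fst)).measurable
    have h₂ := PointScattering.integral_comp_fiberwise hΘ₂ (c := fun σ =>
      (1 + lam • PointScattering.rotMat σ).det) hM.matrix_det.measurable hdet
      (fun σ => PointScattering.map_act_shear (hdet σ) lam) hint₁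
    simp only [PointScattering.formIntegrand₁_act_inv α₀ l₀ lam f g _ _ (hdet _).ne'] at h₂
    exact ⟨h₂.1, by rw [heq₁, ← h₂.2, integral_prod _ h₂.1]⟩
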